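/- Let $\hbar>0$ and let $\mu$ be a Borel probability measure on $\mathbb R$ (the law of a random momentum kick; for instance $d\mu(p)=\tilde g(p)\,dp$ with a probability density $\tilde g$). Let $\hat X$ be the position operator on $L^2(\mathbb R)$, so that $(e^{\frac{i}{\hbar}p\hat X}\psi)(x)=e^{\frac{i}{\hbar}px}\psi(x)$. Define the position-dephasing channel $$\Delta_g(\rho)=\int_{\mathbb R} e^{\frac{i}{\hbar}p\hat X}\,\rho\,e^{-\frac{i}{\hbar}p\hat X}\,d\mu(p)$$ (strong operator integral), and the dephasing function $g(\xi)=\int_{\mathbb R}e^{\frac{i}{\hbar}p\xi}\,d\mu(p)$. A state is a positive trace-class operator on $L^2(\mathbb R)$ of trace $1$; a pure state is an operator $|\psi\rangle\langle\psi|$ with $\psi\in L^2(\mathbb R)$, $\|\psi\|=1$. Let $$\mathcal I_{\mathrm{img}}^g=\{\rho \text{ a state}:\ \text{there is a state } \sigma \text{ with } \rho=\Delta_g(\sigma)\}.$$ **Proposition.** Assume $0<|g(\xi)|<1$ for almost every $\xi\neq 0$. Then no pure state belongs to $\mathcal I_{\mathrm{img}}^g$. -/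

import Mathlib

open MeasureTheory Filter Topology
open scoped ENNReal InnerProductSpace

noncomputable section

namespace PositionDephasing

/-- The Hilbert space `L²(ℝ)` of a particle on the line. -/
abbrev H : Type := Lp ℂ 2 (volume : Measure ℝ)

/-- The phase `x ↦ exp (i p x / ħ)`. -/
def phase (hbar p x : ℝ) : ℂ := Complex.exp (Complex.I * ((p * x / hbar : ℝ) : ℂ))

lemma norm_phase (hbar p x : ℝ) : ‖phase hbar p x‖ = 1 := by
  unfold phase
  rw [mul_comm]
  exact Complex.norm_exp_ofReal_mul_I _

lemma continuous_phase (hbar p : ℝ) : Continuous (phase hbar p) := by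
  unfold phase
  fun_prop

lemma continuous_phase_left (hbar x : ℝ) : Continuous (fun p => phase hbar p x) := by
  unfold phase
  fun_prop

lemma memLp_phase_mul (hbar p : ℝ) (f : H) :
    MemLp (fun x => phase hbar p x * f x) 2 (volume : Measure ℝ) := by
  refine (Lp.memLp f).of_le ((continuous_phase hbar p).aestronglyMeasurable.mul
    (Lp.memLp f).aestronglyMeasurable) (Eventually.of_forall fun x => ?_)
  simp [norm_phase]

/-- The vector `exp (i p X / ħ) f`, where `X` is the position operator: the function
`x ↦ exp (i p x / ħ) f x`. -/
def kickVec (hbar p : ℝ) (f : H) : H := (memLp_phase_mul hbar p f).toLp _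

lemma coeFn_kickVec (hbar p : ℝ) (f : H) :
    ∀ᵐ x : ℝ, kickVec hbar p f x = phase hbar p x * f x :=
  (memLp_phase_mul hbar p f).coeFn_toLp

lemma norm_kickVec (hbar p : ℝ) (f : H) : ‖kickVec hbar p f‖ = ‖f‖ := by
  rw [Lp.norm_def, Lp.norm_def]
  congr 1
  refine eLpNorm_congr_norm_ae ?_
  filter_upwards [coeFn_kickVec hbar p f] with x hx
  rw [hx, norm_mul, norm_phase, one_mul]

/-- The momentum kick `exp (i p X / ħ)`, as an operator on `L²(ℝ)`. -/
def kick (hbar p : ℝ) : H →L[ℂ] H :=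
  LinearMap.mkContinuous
    { toFun := kickVec hbar p
      map_add' := fun f h => by
        ext1
        filter_upwards [coeFn_kickVec hbar p (f + h), coeFn_kickVec hbar p f,
          coeFn_kickVec hbar p h, Lp.coeFn_add f h,
          Lp.coeFn_add (kickVec hbar p f) (kickVec hbar p h)] with x h1 h2 h3 h4 h5
        rw [h1, h5, h4, Pi.add_apply, Pi.add_apply, h2, h3, mul_add]
      map_smul' := fun c f => by
        ext1
        filter_upwards [coeFn_kickVec hbar p (c • f), coeFn_kickVec hbar p f,
          Lp.coeFn_smul c f, Lp.coeFn_smul c (kickVec hbar p f)] with x h1 h2 h3 h4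
        simp only [RingHom.id_apply]
        rw [h1, h4, h3, Pi.smul_apply, Pi.smul_apply, h2, smul_eq_mul, smul_eq_mul]
        ring }
    1 (fun f => by
        rw [one_mul]
        exact (norm_kickVec hbar p f).le)

lemma kick_apply (hbar p : ℝ) (f : H) : kick hbar p f = kickVec hbar p f := rfl

lemma norm_kick_apply (hbar p : ℝ) (f : H) : ‖kick hbar p f‖ = ‖f‖ := norm_kickVec hbar p f

lemma continuous_kick_apply (hbar : ℝ) (f : H) : Continuous (fun p => kick hbar p f) := by
  rw [continuous_iff_continuousAt]
  intro q
  unfold ContinuousAt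
  rw [Lp.tendsto_Lp_iff_tendsto_eLpNorm']
  have key : Tendsto (fun p : ℝ => ∫⁻ x : ℝ, ‖phase hbar p x * f x - phase hbar q x * f x‖ₑ ^ (2 : ℝ))
      (𝓝 q) (𝓝 (∫⁻ _ : ℝ, 0)) := by
    have hb : ∫⁻ x : ℝ, (2 * ‖f x‖ₑ) ^ (2 : ℝ) ≠ ∞ := by
      have h := (Lp.memLp f).eLpNorm_lt_top
      rw [eLpNorm_lt_top_iff_lintegral_rpow_enorm_lt_top (by norm_num) (by norm_num)] at h
      simp only [ENNReal.toReal_ofNat] at h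
      simp_rw [ENNReal.mul_rpow_of_nonneg _ _ (by norm_num : (0 : ℝ) ≤ 2)]
      rw [lintegral_const_mul' _ _ (by simp)]
      exact ENNReal.mul_ne_top (by simp) h.ne
    refine tendsto_lintegral_filter_of_dominated_convergence'
      (fun x : ℝ => (2 * ‖f x‖ₑ) ^ (2 : ℝ)) ?_ ?_ hb ?_
    · refine Eventually.of_forall fun p => ?_
      exact (((continuous_phase hbar p).aestronglyMeasurable.mul
        (Lp.memLp f).aestronglyMeasurable).sub ((continuous_phase hbar q).aestronglyMeasurable.mul
        (Lp.memLp f).aestronglyMeasurable)).enorm.pow_const _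
    · refine Eventually.of_forall fun p => Eventually.of_forall fun x => ?_
      refine ENNReal.rpow_le_rpow ?_ (by norm_num)
      refine (enorm_sub_le).trans ?_
      simp only [enorm_mul]
      have h1 : ∀ r : ℝ, ‖phase hbar r x‖ₑ = 1 := fun r => by
        rw [← ofReal_norm, norm_phase, ENNReal.ofReal_one]
      rw [h1, h1, one_mul, two_mul]
    · refine Eventually.of_forall fun x => ?_
      have hc : Continuous fun p : ℝ => ‖phase hbar p x * f x - phase hbar q x * f x‖ₑ ^ (2 : ℝ) := by
        have := continuous_phase_left hbar x
        exact (ENNReal.continuous_rpow_const).comp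
          (((this.mul continuous_const).sub continuous_const).enorm)
      have := hc.tendsto q
      simpa using this
  rw [lintegral_zero] at key
  have key2 := (ENNReal.continuous_rpow_const (y := 1 / (2 : ℝ))).tendsto 0 |>.comp key
  rw [ENNReal.zero_rpow_of_pos (by norm_num)] at key2
  refine key2.congr fun p => ?_
  rw [eLpNorm_eq_lintegral_rpow_enorm_toReal (by norm_num) (by norm_num)]
  simp only [ENNReal.toReal_ofNat, Function.comp_apply]
  congr 1
  refine lintegral_congr_ae ?_
  filter_upwards [coeFn_kickVec hbar p f, coeFn_kickVec hbar q f] with x h1 h2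
  simp only [kick_apply, Pi.sub_apply]
  rw [h1, h2]

lemma continuous_kick_conj (hbar : ℝ) (ρ : H →L[ℂ] H) (f : H) :
    Continuous (fun p => kick hbar p (ρ (kick hbar (-p) f))) := by
  have hv : Continuous fun p => ρ (kick hbar (-p) f) :=
    ρ.continuous.comp ((continuous_kick_apply hbar f).comp continuous_neg)
  rw [continuous_iff_continuousAt]
  intro q
  have h1 : Tendsto (fun p => kick hbar p (ρ (kick hbar (-p) f) - ρ (kick hbar (-q) f)))
      (𝓝 q) (𝓝 0) := by
    rw [tendsto_zero_iff_norm_tendsto_zero]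
    simp_rw [norm_kick_apply]
    have := (hv.sub (continuous_const (y := ρ (kick hbar (-q) f)))).norm.tendsto q
    simpa using this
  have h2 := h1.add ((continuous_kick_apply hbar (ρ (kick hbar (-q) f))).tendsto q)
  rw [zero_add] at h2
  refine h2.congr fun p => ?_
  rw [map_sub, sub_add_cancel]

lemma norm_kick_conj_le (hbar p : ℝ) (ρ : H →L[ℂ] H) (f : H) :
    ‖kick hbar p (ρ (kick hbar (-p) f))‖ ≤ ‖ρ‖ * ‖f‖ := by
  rw [norm_kick_apply]
  refine (ρ.le_opNorm _).trans_eq ?_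
  rw [norm_kick_apply]

lemma integrable_kick_conj (hbar : ℝ) (μ : Measure ℝ) [IsProbabilityMeasure μ]
    (ρ : H →L[ℂ] H) (f : H) :
    Integrable (fun p => kick hbar p (ρ (kick hbar (-p) f))) μ :=
  (integrable_const (‖ρ‖ * ‖f‖)).mono' (continuous_kick_conj hbar ρ f).aestronglyMeasurable
    (Eventually.of_forall fun p => norm_kick_conj_le hbar p ρ f)

/-- The random-momentum-kick dephasing channel
`Δ_g(ρ) = ∫ exp (i p X / ħ) ρ exp (-i p X / ħ) dμ(p)`, where `μ` is the law of the kick. The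
integral is taken in the strong operator sense, on each vector of `L²(ℝ)`. -/
def dephasing (hbar : ℝ) (μ : Measure ℝ) [IsProbabilityMeasure μ] (ρ : H →L[ℂ] H) : H →L[ℂ] H :=
  LinearMap.mkContinuous
    { toFun := fun f => ∫ p, kick hbar p (ρ (kick hbar (-p) f)) ∂μ
      map_add' := fun f h => by
        simp only [map_add]
        exact integral_add (integrable_kick_conj hbar μ ρ f) (integrable_kick_conj hbar μ ρ h)
      map_smul' := fun c f => by
        simp only [map_smul, RingHom.id_apply]
        exact integral_smul c _ }
    ‖ρ‖ (fun f => by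
      refine (norm_integral_le_of_norm_le_const
        (Eventually.of_forall fun p => norm_kick_conj_le hbar p ρ f)).trans_eq ?_
      simp)

/-- The dephasing function `g(ξ) = ∫ exp (i p ξ / ħ) dμ(p)`, the characteristic function of the
law `μ` of the momentum kick. -/
def dephasingFunction (hbar : ℝ) (μ : Measure ℝ) (ξ : ℝ) : ℂ := ∫ p, phase hbar p ξ ∂μ

/-- A state (density operator) on `L²(ℝ)`: a positive trace-class operator of trace one. A positive
operator is trace class with trace `t` exactly if its diagonal entries in an orthonormal basis
sum to `t`; neither the summability nor the sum depends on the basis. -/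
structure IsState (ρ : H →L[ℂ] H) : Prop where
  isPositive : ρ.IsPositive
  trace_eq_one : ∀ {ι : Type} (b : HilbertBasis ι ℂ H), HasSum (fun i => ⟪b i, ρ (b i)⟫_ℂ) 1

/-- A pure state `|ψ⟩⟨ψ|`, with `ψ` a unit vector of `L²(ℝ)`. -/
def IsPureState (ρ : H →L[ℂ] H) : Prop :=
  ∃ ψ : H, ‖ψ‖ = 1 ∧ ρ = InnerProductSpace.rankOne ℂ ψ ψ

/-- The image-incoherent states: the states `ρ = Δ_g(σ)` for some state `σ`. -/
def imageIncoherent (hbar : ℝ) (μ : Measure ℝ) [IsProbabilityMeasure μ] : Set (H →L[ℂ] H) :=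
  {ρ | IsState ρ ∧ ∃ σ : H →L[ℂ] H, IsState σ ∧ ρ = dephasing hbar μ σ}

end PositionDephasing

end

/-! Write `U p` for the kick by `p` and suppose `|ψ⟩⟨ψ| = Δ_g(σ)`. At a vector orthogonal to `ψ` the
form of `Δ_g(σ)` vanishes; it is a `μ`-average of nonnegative values of the form of `σ`, so by
continuity `σ` kills the kicked vector `U (-p) f` for every `p` in the support of `μ`. Hence, for
each such `p`, `σ` vanishes on the complement of `U (-p) ψ` and has range in the line through it. As
`σ ≠ 0`, two support points `p ≠ q` would give the same line and make `ψ` an eigenvector of `U (p -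
q)`, which has none. So `μ` is a point mass and `|g| = 1` everywhere, against `|g| < 1`. -/

/-- A positive operator kills every vector at which its quadratic form vanishes. -/
lemma ContinuousLinearMap.IsPositive.apply_eq_zero_of_re_inner_eq_zero {E : Type*}
    [NormedAddCommGroup E] [InnerProductSpace ℂ E] {T : E →L[ℂ] E} (hT : T.IsPositive) {x : E}
    (hx : (⟪x, T x⟫_ℂ).re = 0) : T x = 0 := by
  -- The form at `x - t • T x`, as a quadratic in `t`: its constant term vanishes, so a nonnegative
  -- quadratic forces the linear coefficient to vanish too.
  have hquad : ∀ t : ℝ, 0 ≤ (⟪T x, T (T x)⟫_ℂ).re * (t * t) + (-2 * ‖T x‖ ^ 2) * t + 0 := by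
    intro t
    have h := hT.re_inner_nonneg_right (x - (t : ℂ) • T x)
    have h1 : ⟪x, T (T x)⟫_ℂ = ⟪T x, T x⟫_ℂ := (hT.inner_left_eq_inner_right _ _).symm
    have h2 : (⟪T x, T x⟫_ℂ).re = ‖T x‖ ^ 2 := inner_self_eq_norm_sq (𝕜 := ℂ) (T x)
    simp only [map_sub, map_smul, inner_sub_left, inner_sub_right, inner_smul_left,
      inner_smul_right, h1, Complex.conj_ofReal, RCLike.re_to_complex, Complex.sub_re,
      Complex.re_ofReal_mul, h2, hx] at h
    linarith
  have hd := discrim_le_zero hquad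
  simp only [discrim] at hd
  have h0 : ‖T x‖ ^ 2 = 0 := by nlinarith [sq_nonneg (‖T x‖ ^ 2)]
  simpa using h0

/-- The range of a symmetric operator that vanishes on the orthogonal complement of `u` is
contained in the line spanned by `u`. -/
lemma LinearMap.IsSymmetric.apply_mem_span_singleton {E : Type*} [NormedAddCommGroup E]
    [InnerProductSpace ℂ E] {T : E →ₗ[ℂ] E} (hT : T.IsSymmetric) {u : E}
    (hu : ∀ w, ⟪w, u⟫_ℂ = 0 → T w = 0) (x : E) : T x ∈ Submodule.span ℂ {u} := by
  rw [← (Submodule.span ℂ {u}).orthogonal_orthogonal, Submodule.mem_orthogonal]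
  intro w hw
  rw [← hT, hu w (Submodule.mem_orthogonal_singleton_iff_inner_left.mp hw), inner_zero_left]

namespace PositionDephasing

lemma star_phase (hbar p x : ℝ) : starRingEnd ℂ (phase hbar p x) = phase hbar (-p) x := by
  simp only [phase, ← Complex.exp_conj, map_mul, Complex.conj_I, Complex.conj_ofReal]
  congr 1
  push_cast
  ring

lemma phase_add (hbar p q x : ℝ) :
    phase hbar (p + q) x = phase hbar p x * phase hbar q x := by
  simp only [phase, ← Complex.exp_add]
  congr 1
  push_cast
  ring

lemma phase_zero (hbar x : ℝ) : phase hbar 0 x = 1 := by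
  simp [phase]

lemma kick_kick (hbar p q : ℝ) (f : H) : kick hbar p (kick hbar q f) = kick hbar (p + q) f := by
  simp only [kick_apply]
  ext1
  filter_upwards [coeFn_kickVec hbar p (kickVec hbar q f), coeFn_kickVec hbar q f,
    coeFn_kickVec hbar (p + q) f] with x h1 h2 h3
  rw [h1, h2, h3, phase_add, mul_assoc]

lemma kick_zero (hbar : ℝ) (f : H) : kick hbar 0 f = f := by
  rw [kick_apply]
  ext1
  filter_upwards [coeFn_kickVec hbar 0 f] with x h
  rw [h, phase_zero, one_mul]

lemma inner_kick_right (hbar p : ℝ) (f h : H) :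
    ⟪f, kick hbar p h⟫_ℂ = ⟪kick hbar (-p) f, h⟫_ℂ := by
  rw [L2.inner_def, L2.inner_def]
  refine integral_congr_ae ?_
  filter_upwards [coeFn_kickVec hbar p h, coeFn_kickVec hbar (-p) f] with x h1 h2
  rw [kick_apply, kick_apply, h1, h2, RCLike.inner_apply, RCLike.inner_apply, map_mul, star_phase,
    neg_neg]
  ring

/-- For positive `σ` this is an average of nonnegative numbers, so it vanishes only if almost all of
them do. -/
lemma inner_dephasing (hbar : ℝ) (μ : Measure ℝ) [IsProbabilityMeasure μ] (σ : H →L[ℂ] H)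
    (f : H) : ⟪f, dephasing hbar μ σ f⟫_ℂ =
      ∫ p, ⟪kick hbar (-p) f, σ (kick hbar (-p) f)⟫_ℂ ∂μ := by
  have h : dephasing hbar μ σ f = ∫ p, kick hbar p (σ (kick hbar (-p) f)) ∂μ := rfl
  rw [h, ← integral_inner (integrable_kick_conj hbar μ σ f)]
  simp only [inner_kick_right]

/-- If the quadratic form of `Δ_g(σ)` vanishes at `f`, then `σ` kills all kicked copies of `f`
for kicks in the support of `μ`. -/
lemma apply_kick_neg_eq_zero_of_mem_support {hbar : ℝ} {μ : Measure ℝ} [IsProbabilityMeasure μ]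
    {σ : H →L[ℂ] H} (hσ : σ.IsPositive) {f : H} (hf : ⟪f, dephasing hbar μ σ f⟫_ℂ = 0) {p : ℝ}
    (hp : p ∈ μ.support) : σ (kick hbar (-p) f) = 0 := by
  have hint : Integrable (fun p => ⟪kick hbar (-p) f, σ (kick hbar (-p) f)⟫_ℂ) μ := by
    simpa only [inner_kick_right] using (integrable_kick_conj hbar μ σ f).const_inner (𝕜 := ℂ) f
  have hcont : Continuous fun p => (σ (kick hbar (-p) f)) :=
    σ.continuous.comp ((continuous_kick_apply hbar f).comp continuous_neg)
  have hre : ∫ p, (⟪kick hbar (-p) f, σ (kick hbar (-p) f)⟫_ℂ).re ∂μ = 0 := by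
    have h := integral_re hint
    simp only [RCLike.re_to_complex] at h
    rw [h, ← inner_dephasing, hf, Complex.zero_re]
  have hae := (integral_eq_zero_iff_of_nonneg (fun p => hσ.re_inner_nonneg_right _) hint.re).mp hre
  -- The zero set of a continuous map is closed; having full measure, it contains the support. This
  -- upgrades "almost every `p`" to "every `p` in the support".
  exact Measure.support_subset_of_isClosed (isClosed_eq hcont continuous_const)
    (hae.mono fun q hq => hσ.apply_eq_zero_of_re_inner_eq_zero hq) hp

lemma dephasing_zero (hbar : ℝ) (μ : Measure ℝ) [IsProbabilityMeasure μ] :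
    dephasing hbar μ 0 = 0 := by
  ext1 f
  change ∫ p, kick hbar p ((0 : H →L[ℂ] H) (kick hbar (-p) f)) ∂μ = 0
  simp

/-- Two solutions differ by an integer multiple of `2πħ/t`. -/
lemma countable_setOf_phase_eq {hbar t : ℝ} (hbar_ne : hbar ≠ 0) (ht : t ≠ 0) (c : ℂ) :
    {x : ℝ | phase hbar t x = c}.Countable := by
  rcases {x : ℝ | phase hbar t x = c}.eq_empty_or_nonempty with h | ⟨y, hy⟩
  · simp [h]
  refine (Set.countable_range fun n : ℤ => y + n * (2 * Real.pi) * hbar / t).mono ?_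
  intro x hx
  have hxy : phase hbar t x = phase hbar t y := hx.trans hy.symm
  obtain ⟨n, hn⟩ := Complex.exp_eq_exp_iff_exists_int.mp hxy
  have h : t * x / hbar = t * y / hbar + n * (2 * Real.pi) := by
    have h' : Complex.I * ((t * x / hbar : ℝ) : ℂ) =
        Complex.I * ((t * y / hbar + n * (2 * Real.pi) : ℝ) : ℂ) := by
      rw [hn]
      push_cast
      ring
    exact_mod_cast mul_left_cancel₀ Complex.I_ne_zero h'
  refine ⟨n, ?_⟩
  field_simp at h ⊢
  linarith

/-- A nontrivial momentum kick has no eigenvectors. -/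
lemma eq_zero_of_kick_eq_smul {hbar t : ℝ} (hbar_ne : hbar ≠ 0) (ht : t ≠ 0) {c : ℂ} {f : H}
    (h : kick hbar t f = c • f) : f = 0 := by
  have hc : ∀ᵐ x : ℝ, phase hbar t x ≠ c :=
    (countable_setOf_phase_eq hbar_ne ht c).measure_zero volume |> compl_mem_ae_iff.mpr
  ext1
  filter_upwards [hc, coeFn_kickVec hbar t f, Lp.coeFn_smul c f, Lp.coeFn_zero ℂ 2 volume]
    with x h1 h2 h3 h4
  rw [← kick_apply, h, h3, Pi.smul_apply, smul_eq_mul] at h2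
  rw [h4]
  by_contra hx
  exact h1 (mul_right_cancel₀ hx h2).symm

/-- A kick distribution that maps some positive operator to a pure state is concentrated at one
point. -/
lemma support_subsingleton_of_rankOne_eq_dephasing {hbar : ℝ} (hbar_ne : hbar ≠ 0)
    {μ : Measure ℝ} [IsProbabilityMeasure μ] {σ : H →L[ℂ] H} (hσ : σ.IsPositive) {ψ : H}
    (hψ : ψ ≠ 0) (h : InnerProductSpace.rankOne ℂ ψ ψ = dephasing hbar μ σ) :
    μ.support.Subsingleton := by
  have hker : ∀ p ∈ μ.support, ∀ w, ⟪w, kick hbar (-p) ψ⟫_ℂ = 0 → σ w = 0 := by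
    intro p hp w hw
    rw [inner_kick_right, neg_neg] at hw
    -- The test vector `kick hbar p w` is orthogonal to `ψ`, and undoing the kick at this same `p`
    -- returns `w`.
    have hf : ⟪kick hbar p w, dephasing hbar μ σ (kick hbar p w)⟫_ℂ = 0 := by
      rw [← h, InnerProductSpace.rankOne_apply, inner_smul_right, hw, mul_zero]
    simpa only [kick_kick, neg_add_cancel, kick_zero] using
      apply_kick_neg_eq_zero_of_mem_support hσ hf hp
  obtain ⟨x, hx⟩ : ∃ x, σ x ≠ 0 := by
    by_contra! hσ0
    have : σ = 0 := by
      ext1 x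
      exact hσ0 x
    rw [this, dephasing_zero] at h
    have h' := DFunLike.congr_fun h ψ
    simp [InnerProductSpace.rankOne_apply, hψ] at h'
  intro p hp q hq
  by_contra hpq
  obtain ⟨a, ha⟩ := Submodule.mem_span_singleton.mp
    (hσ.isSymmetric.apply_mem_span_singleton (hker p hp) x)
  obtain ⟨b, hb⟩ := Submodule.mem_span_singleton.mp
    (hσ.isSymmetric.apply_mem_span_singleton (hker q hq) x)
  have hb0 : b ≠ 0 := by
    rintro rfl
    exact hx (by simpa using hb.symm)
  refine hψ (eq_zero_of_kick_eq_smul hbar_ne (t := p - q) (sub_ne_zero.mpr hpq)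
    (c := b⁻¹ * a) ?_)
  -- Both multiples, of `U (-p) ψ` and of `U (-q) ψ`, equal `σ x`; apply `U p`.
  have hab : a • ψ = b • kick hbar (p - q) ψ := by
    have := congrArg (kick hbar p) (ha.trans hb.symm)
    simpa only [map_smul, kick_kick, add_neg_cancel, kick_zero, ← sub_eq_add_neg] using this
  rw [mul_smul, hab, inv_smul_smul₀ hb0]

/-- The support carries all the mass, so the average defining `g` reduces to a single phase. -/
lemma norm_dephasingFunction_of_support_subsingleton {hbar : ℝ} {μ : Measure ℝ}
    [IsProbabilityMeasure μ] (h : μ.support.Subsingleton) (ξ : ℝ) :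
    ‖dephasingFunction hbar μ ξ‖ = 1 := by
  obtain ⟨q, hq⟩ := Measure.nonempty_support (IsProbabilityMeasure.ne_zero μ)
  have hae : ∀ᵐ p ∂μ, phase hbar p ξ = phase hbar q ξ := by
    filter_upwards [Measure.support_mem_ae (μ := μ)] with p hp
    rw [h hp hq]
  rw [dephasingFunction, integral_congr_ae hae]
  simp [norm_phase]

end PositionDephasing

theorem mainTheorem11 (hbar : ℝ) (hbar_pos : 0 < hbar)
    (μ : MeasureTheory.Measure ℝ) [MeasureTheory.IsProbabilityMeasure μ]
    (hg : ∀ᵐ ξ : ℝ ∂MeasureTheory.volume, ξ ≠ 0 →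
      0 < ‖PositionDephasing.dephasingFunction hbar μ ξ‖ ∧
        ‖PositionDephasing.dephasingFunction hbar μ ξ‖ < 1) :
    ∀ ρ : PositionDephasing.H →L[ℂ] PositionDephasing.H,
      PositionDephasing.IsPureState ρ → ρ ∉ PositionDephasing.imageIncoherent hbar μ := by
  rintro ρ ⟨ψ, hψ, rfl⟩ ⟨-, σ, hσ, h⟩
  have hψ0 : ψ ≠ 0 := norm_ne_zero_iff.mp (by simp [hψ])
  have hsupp := PositionDephasing.support_subsingleton_of_rankOne_eq_dephasing hbar_pos.ne'
    hσ.isPositive hψ0 h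
  -- One nonzero `ξ` where the bound holds is enough, since `|g| = 1` at every point.
  obtain ⟨ξ, hξ, hξ0⟩ := (hg.and (Measure.ae_ne volume 0)).exists
  exact (hξ hξ0).2.ne
    (PositionDephasing.norm_dephasingFunction_of_support_subsingleton hsupp ξ)
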